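/- Let $V\subset\mathbb R^n$ be a homogeneous cone, that is: $V$ is a non-empty open set with $\lambda x\in V$ and $x+y\in V$ for all $x,y\in V$, $\lambda>0$; if $x\in\overline V$ and $x\neq 0$ then $-x\notin\overline V$; and the group $G(V)$ of all real $n\times n$ matrices mapping $V$ onto $V$ acts transitively on $V$. Let $$V^*=\{x\in\mathbb R^n : x\cdot y>0 \text{ for every } y\in\overline V,\ y\ne 0\}$$ be its dual cone, and for $W\in\{V,V^*\}$ and $x\in W$ let $\Delta_W(x)$ be the Lebesgue measure of the cone interval $\langle 0,x\rangle=\{y\in W : x-y\in W\}$. Let $1\le p\le q<\infty$, put $1/p'=1-1/p$, and let $\beta,\gamma,\delta\in\mathbb R$. Let $k:V^*\times V\to[0,\infty)$ be a (Lebesgue) measurable kernel that is $V^*\times V$-homogeneous of order $\beta$, i.e. $$k\big((A^{t})^{-1}x,\,Ay\big)=|\det A|^{\beta}\,k(x,y)\qquad\text{for all }A\in G(V),\ x\in V^*,\ y\in V,$$ and let $Kf(x)=\int_V k(x,y)f(y)\,dy$ for $x\in V^*$ and measurable $f:V\to[0,\infty)$. Suppose that $$\int_V k(x,y)\,\Delta_V^{\delta}(y)\,dy<\infty\quad\text{for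 every }x\in V^*$$ and $$\int_{V^*}k^{q/p}(x,y)\,\Delta_{V^*}^{-\gamma+q-2-(\delta+\beta+1)q/p'}(x)\,dx<\infty\quad\text{for every }y\in V.$$ Then there is a finite constant $c\ge 0$, independent of $f$, such that for every measurable $f:V\to[0,\infty)$ $$\left(\int_{V^*}(Kf(x))^{q}\,\Delta_{V^*}^{-\gamma+q-2}(x)\,dx\right)^{1/q}\le c\left(\int_V f^{p}(y)\,\Delta_V^{\beta p+(\gamma+1)p/q-1}(y)\,dy\right)^{1/p},$$ where both sides are allowed to be $+\infty$. -/

import Mathlib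

open MeasureTheory
open scoped NNReal ENNReal Matrix

/-- The action of an `n × n` real matrix on Euclidean space `ℝⁿ`. -/
noncomputable abbrev matAct {n : ℕ} (A : Matrix (Fin n) (Fin n) ℝ)
    (x : EuclideanSpace ℝ (Fin n)) : EuclideanSpace ℝ (Fin n) :=
  Matrix.toEuclideanLin A x

/-- An open convex cone in `ℝⁿ` containing no line: a non-empty open set closed under positive
scaling and addition, whose closure meets its negative at most in `0`. -/
structure IsOpenCone {n : ℕ} (V : Set (EuclideanSpace ℝ (Fin n))) : Prop where
  nonempty : V.Nonempty
  isOpen : IsOpen V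
  smul_mem : ∀ x ∈ V, ∀ r : ℝ, 0 < r → r • x ∈ V
  add_mem : ∀ x ∈ V, ∀ y ∈ V, x + y ∈ V
  neg_notMem_closure : ∀ x ∈ closure V, x ≠ 0 → -x ∉ closure V

/-- The dual cone `V* = {x : x · y > 0 for every y ∈ closure V, y ≠ 0}`. -/
def dualCone {n : ℕ} (V : Set (EuclideanSpace ℝ (Fin n))) : Set (EuclideanSpace ℝ (Fin n)) :=
  {x | ∀ y ∈ closure V, y ≠ 0 → 0 < inner ℝ x y}

/-- The automorphism group `G(V)`: the matrices mapping `V` onto `V`. If `V` is open and non-empty,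
these are automatically invertible. -/
def coneAut {n : ℕ} (V : Set (EuclideanSpace ℝ (Fin n))) : Set (Matrix (Fin n) (Fin n) ℝ) :=
  {A | matAct A '' V = V}

/-- A homogeneous cone: a cone on which `G(V)` acts transitively. -/
structure IsHomogeneousCone {n : ℕ} (V : Set (EuclideanSpace ℝ (Fin n))) : Prop
    extends IsOpenCone V where
  transitive : ∀ x ∈ V, ∀ y ∈ V, ∃ A ∈ coneAut V, y = matAct A x

/-- The cone interval `⟨a, b⟩ = {x ∈ V : a <_V x <_V b}`, where `a <_V b` means `b - a ∈ V`. -/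
def coneInterval {n : ℕ} (V : Set (EuclideanSpace ℝ (Fin n)))
    (a b : EuclideanSpace ℝ (Fin n)) : Set (EuclideanSpace ℝ (Fin n)) :=
  {x | x ∈ V ∧ x - a ∈ V ∧ b - x ∈ V}

/-- `Δ_V(x)`, the Lebesgue measure of the cone interval `⟨0, x⟩`. -/
noncomputable def coneDelta {n : ℕ} (V : Set (EuclideanSpace ℝ (Fin n)))
    (x : EuclideanSpace ℝ (Fin n)) : ℝ≥0∞ :=
  volume (coneInterval V 0 x)

/-- A kernel `k : V* × V → [0, ∞)` is `V* × V`-homogeneous of order `β` if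
`k((Aᵗ)⁻¹ x, A y) = |det A| ^ β k(x, y)` for all `A ∈ G(V)`. Values of `k` outside `V* × V`
are irrelevant. -/
def IsDualHomogeneousKernel {n : ℕ} (V : Set (EuclideanSpace ℝ (Fin n)))
    (k : EuclideanSpace ℝ (Fin n) → EuclideanSpace ℝ (Fin n) → ℝ≥0) (β : ℝ) : Prop :=
  ∀ A ∈ coneAut V, ∀ x ∈ dualCone V, ∀ y ∈ V,
    (k (matAct (Aᵀ)⁻¹ x) (matAct A y) : ℝ) = |A.det| ^ β * (k x y : ℝ)

/-- The integral operator `K f (x) = ∫_V k(x, y) f(y) dy`, with values in `[0, ∞]`. -/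
noncomputable def kernelOp {n : ℕ} (V : Set (EuclideanSpace ℝ (Fin n)))
    (k : EuclideanSpace ℝ (Fin n) → EuclideanSpace ℝ (Fin n) → ℝ≥0)
    (f : EuclideanSpace ℝ (Fin n) → ℝ≥0) (x : EuclideanSpace ℝ (Fin n)) : ℝ≥0∞ :=
  ∫⁻ y in V, (k x y : ℝ≥0∞) * (f y : ℝ≥0∞)

/-! ### Matrices acting on Euclidean space -/

section MatAct

variable {n : ℕ}

/-! The two hypotheses are the two halves of a weighted Schur test, once their integrals are known
exactly. Changing variables by `A ∈ G(V)` shows that each integral, as a function of its free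
variable, is multiplied by a fixed power of `|det A|` (`IsDualHomogeneousKernel.lintegral_left`,
`IsDualHomogeneousKernel.lintegral_right`), and so is `Δ` (`coneDelta_matAct`). By transitivity each
finite integral is therefore a constant times a power of `Δ` (`exists_eq_const_mul_rpow`).
`weighted_schur_test` then gives the inequality, and the exponents match identically.

Transitivity is assumed on `V` but also needed on `V*`, for the contragredient action. It is
transported through the centroid of `V` under the weight `exp (-⟪y, x⟫)`: this map from `V*` to `V`
is equivariant (`coneCentroid_matAct`), lands in `V` (`coneCentroid_mem`) and is injective
(`coneCentroid_injOn`). Surjectivity is not needed. -/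

theorem matAct_mul (A B : Matrix (Fin n) (Fin n) ℝ) (x : EuclideanSpace ℝ (Fin n)) :
    matAct (A * B) x = matAct A (matAct B x) := by
  simp [matAct]

theorem matAct_one (x : EuclideanSpace ℝ (Fin n)) : matAct 1 x = x := by
  simp [matAct]

theorem matAct_inv_matAct {A : Matrix (Fin n) (Fin n) ℝ} (hA : A.det ≠ 0)
    (x : EuclideanSpace ℝ (Fin n)) : matAct A⁻¹ (matAct A x) = x := by
  rw [← matAct_mul, Matrix.nonsing_inv_mul _ (isUnit_iff_ne_zero.2 hA), matAct_one]

theorem matAct_matAct_inv {A : Matrix (Fin n) (Fin n) ℝ} (hA : A.det ≠ 0)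
    (x : EuclideanSpace ℝ (Fin n)) : matAct A (matAct A⁻¹ x) = x := by
  rw [← matAct_mul, Matrix.mul_nonsing_inv _ (isUnit_iff_ne_zero.2 hA), matAct_one]

theorem matAct_injective {A : Matrix (Fin n) (Fin n) ℝ} (hA : A.det ≠ 0) :
    Function.Injective (matAct A) :=
  Function.LeftInverse.injective (matAct_inv_matAct hA)

theorem continuous_matAct (A : Matrix (Fin n) (Fin n) ℝ) : Continuous (matAct A) :=
  LinearMap.continuous_of_finiteDimensional (Matrix.toEuclideanLin A)

theorem inner_matAct_transpose (A : Matrix (Fin n) (Fin n) ℝ) (x y : EuclideanSpace ℝ (Fin n)) :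
    inner ℝ (matAct Aᵀ x) y = inner ℝ x (matAct A y) := by
  have h := Matrix.toEuclideanLin_conjTranspose_eq_adjoint (𝕜 := ℝ) A
  rw [Matrix.conjTranspose_eq_transpose_of_trivial] at h
  rw [matAct, h, LinearMap.adjoint_inner_left]

theorem inner_matAct_transpose_inv {A : Matrix (Fin n) (Fin n) ℝ} (hA : A.det ≠ 0)
    (x y : EuclideanSpace ℝ (Fin n)) :
    inner ℝ (matAct (Aᵀ)⁻¹ x) (matAct A y) = inner ℝ x y := by
  rw [← inner_matAct_transpose, matAct_matAct_inv (by rwa [Matrix.det_transpose])]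

theorem lintegral_image_matAct {A : Matrix (Fin n) (Fin n) ℝ} (hA : A.det ≠ 0)
    {S : Set (EuclideanSpace ℝ (Fin n))} (hS : MeasurableSet S)
    (g : EuclideanSpace ℝ (Fin n) → ℝ≥0∞) :
    ∫⁻ x in matAct A '' S, g x = ENNReal.ofReal |A.det| * ∫⁻ x in S, g (matAct A x) := by
  let L : EuclideanSpace ℝ (Fin n) →L[ℝ] EuclideanSpace ℝ (Fin n) :=
    (Matrix.toEuclideanLin A).toContinuousLinearMap
  have hdet : L.det = A.det := LinearMap.det_toLpLin 2 A
  have h := lintegral_image_eq_lintegral_abs_det_fderiv_mul volume hS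
    (f := matAct A) (f' := fun _ => L) (fun x _ => L.hasFDerivAt.hasFDerivWithinAt)
    (matAct_injective hA).injOn g
  rw [h, lintegral_const_mul' _ _ ENNReal.ofReal_ne_top, hdet]

theorem integral_image_matAct {F : Type*} [NormedAddCommGroup F] [NormedSpace ℝ F]
    {A : Matrix (Fin n) (Fin n) ℝ} (hA : A.det ≠ 0)
    {S : Set (EuclideanSpace ℝ (Fin n))} (hS : MeasurableSet S)
    (g : EuclideanSpace ℝ (Fin n) → F) :
    ∫ x in matAct A '' S, g x = |A.det| • ∫ x in S, g (matAct A x) := by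
  let L : EuclideanSpace ℝ (Fin n) →L[ℝ] EuclideanSpace ℝ (Fin n) :=
    (Matrix.toEuclideanLin A).toContinuousLinearMap
  have hdet : L.det = A.det := LinearMap.det_toLpLin 2 A
  have h := integral_image_eq_integral_abs_det_fderiv_smul volume hS
    (f := matAct A) (f' := fun _ => L) (fun x _ => L.hasFDerivAt.hasFDerivWithinAt)
    (matAct_injective hA).injOn g
  rw [h, integral_smul, hdet]

theorem volume_image_matAct (A : Matrix (Fin n) (Fin n) ℝ) (S : Set (EuclideanSpace ℝ (Fin n))) :
    volume (matAct A '' S) = ENNReal.ofReal |A.det| * volume S := by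
  have h := Measure.addHaar_image_linearMap volume (Matrix.toEuclideanLin A) S
  rwa [LinearMap.det_toLpLin] at h

end MatAct

/-! ### Automorphisms of a cone and of its dual -/

section Cone

variable {n : ℕ} {V : Set (EuclideanSpace ℝ (Fin n))}

/-- The range of `A` is a subspace containing the non-empty open set `V`, hence is the whole space.
-/
theorem det_ne_zero_of_mem_coneAut (hne : V.Nonempty) (ho : IsOpen V)
    {A : Matrix (Fin n) (Fin n) ℝ} (hA : A ∈ coneAut V) : A.det ≠ 0 := by
  have htop : LinearMap.range (Matrix.toEuclideanLin A) = ⊤ := by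
    apply Submodule.eq_top_of_nonempty_interior'
    refine (hne.mono ?_)
    refine interior_maximal ?_ ho
    intro x hx
    have hx' : x ∈ matAct A '' V := by rw [show matAct A '' V = V from hA]; exact hx
    obtain ⟨y, -, rfl⟩ := hx'
    exact ⟨y, rfl⟩
  intro h0
  have hd : LinearMap.det (Matrix.toEuclideanLin A) = 0 := by
    rw [LinearMap.det_toLpLin, h0]
  have := LinearMap.range_lt_top_of_det_eq_zero hd
  exact this.ne htop

theorem matAct_mem_of_mem_coneAut {A : Matrix (Fin n) (Fin n) ℝ} (hA : A ∈ coneAut V)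
    {x : EuclideanSpace ℝ (Fin n)} (hx : x ∈ V) : matAct A x ∈ V := by
  rw [← show matAct A '' V = V from hA]
  exact Set.mem_image_of_mem _ hx

theorem inv_mem_coneAut {A : Matrix (Fin n) (Fin n) ℝ} (hA : A ∈ coneAut V) (hd : A.det ≠ 0) :
    A⁻¹ ∈ coneAut V := by
  change matAct A⁻¹ '' V = V
  conv_lhs => rw [← show matAct A '' V = V from hA]
  rw [Set.image_image]
  simp only [matAct_inv_matAct hd, Set.image_id']

theorem matAct_mem_closure {A : Matrix (Fin n) (Fin n) ℝ} (hA : A ∈ coneAut V)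
    {x : EuclideanSpace ℝ (Fin n)} (hx : x ∈ closure V) : matAct A x ∈ closure V :=
  map_mem_closure (continuous_matAct A) hx fun _ h => matAct_mem_of_mem_coneAut hA h

theorem matAct_transpose_mem_dualCone {A : Matrix (Fin n) (Fin n) ℝ} (hA : A ∈ coneAut V)
    (hd : A.det ≠ 0) {x : EuclideanSpace ℝ (Fin n)} (hx : x ∈ dualCone V) :
    matAct Aᵀ x ∈ dualCone V := by
  intro y hy hy0
  rw [inner_matAct_transpose]
  refine hx _ (matAct_mem_closure hA hy) fun h => hy0 (matAct_injective hd ?_)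
  rw [h]; simp [matAct]

theorem transpose_inv_mem_coneAut_dualCone {A : Matrix (Fin n) (Fin n) ℝ} (hA : A ∈ coneAut V)
    (hd : A.det ≠ 0) : (Aᵀ)⁻¹ ∈ coneAut (dualCone V) := by
  have hdt : Aᵀ.det ≠ 0 := by rwa [Matrix.det_transpose]
  apply Set.Subset.antisymm
  · rintro _ ⟨x, hx, rfl⟩
    rw [← Matrix.transpose_nonsing_inv]
    refine matAct_transpose_mem_dualCone (inv_mem_coneAut hA hd) ?_ hx
    simpa [Matrix.det_nonsing_inv] using hd
  · intro x hx
    exact ⟨matAct Aᵀ x, matAct_transpose_mem_dualCone hA hd hx, matAct_inv_matAct hdt x⟩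

theorem det_transpose_inv (A : Matrix (Fin n) (Fin n) ℝ) : ((Aᵀ)⁻¹).det = A.det⁻¹ := by
  rw [Matrix.det_nonsing_inv, Matrix.det_transpose, Ring.inverse_eq_inv']

/-- Compactness of the unit vectors of `closure V` makes the strict positivity uniform. This
coercivity yields openness of `V*`, boundedness of cone intervals and convergence of the Laplace
integrals. -/
theorem exists_pos_mul_norm_le_inner {y : EuclideanSpace ℝ (Fin n)} (hy : y ∈ dualCone V)
    (hV : ∀ x ∈ V, ∀ r : ℝ, 0 < r → r • x ∈ V) :
    ∃ ε : ℝ, 0 < ε ∧ ∀ x ∈ closure V, ε * ‖x‖ ≤ inner ℝ y x := by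
  have hsmul : ∀ x ∈ closure V, ∀ r : ℝ, 0 < r → r • x ∈ closure V := fun x hx r hr =>
    map_mem_closure (continuous_const_smul r) hx fun z hz => hV z hz r hr
  have hK : IsCompact (closure V ∩ Metric.sphere 0 1) :=
    (isCompact_sphere _ _).inter_left isClosed_closure
  obtain ⟨ε, hε, h⟩ : ∃ ε : ℝ, 0 < ε ∧ ∀ x ∈ closure V ∩ Metric.sphere 0 1, ε ≤ inner ℝ y x := by
    rcases (closure V ∩ Metric.sphere 0 1).eq_empty_or_nonempty with he | hne
    · exact ⟨1, one_pos, by simp [he]⟩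
    · obtain ⟨z, hz, hmin⟩ := hK.exists_isMinOn hne
        (f := fun x => (inner ℝ y x : ℝ)) (by fun_prop)
      refine ⟨inner ℝ y z, hy z hz.1 ?_, fun x hx => hmin hx⟩
      rintro rfl
      simpa using hz.2
  refine ⟨ε, hε, fun x hx => ?_⟩
  rcases eq_or_ne x 0 with rfl | hx0
  · simp
  have hn : 0 < ‖x‖ := norm_pos_iff.2 hx0
  have := h (‖x‖⁻¹ • x) ⟨hsmul x hx _ (inv_pos.2 hn), by simp [norm_smul, hn.ne']⟩
  rw [inner_smul_right] at this
  calc ε * ‖x‖ ≤ ‖x‖⁻¹ * inner ℝ y x * ‖x‖ := by gcongr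
    _ = inner ℝ y x := by field_simp

theorem isOpen_dualCone (hV : ∀ x ∈ V, ∀ r : ℝ, 0 < r → r • x ∈ V) : IsOpen (dualCone V) := by
  rw [Metric.isOpen_iff]
  intro y hy
  obtain ⟨ε, hε, h⟩ := exists_pos_mul_norm_le_inner hy hV
  refine ⟨ε, hε, fun z hz x hx hx0 => ?_⟩
  have hn : 0 < ‖x‖ := norm_pos_iff.2 hx0
  have h1 := h x hx
  have h2 : |inner ℝ (z - y) x| ≤ ‖z - y‖ * ‖x‖ := abs_real_inner_le_norm _ _
  have h3 : ‖z - y‖ * ‖x‖ < ε * ‖x‖ := by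
    have : ‖z - y‖ < ε := by simpa [dist_eq_norm] using hz
    gcongr
  have h4 : (inner ℝ z x : ℝ) = inner ℝ y x + inner ℝ (z - y) x := by
    rw [inner_sub_left]; ring
  have h5 := neg_abs_le (inner ℝ (z - y) x)
  rw [h4]; linarith

theorem smul_mem_dualCone {y : EuclideanSpace ℝ (Fin n)} (hy : y ∈ dualCone V) {r : ℝ}
    (hr : 0 < r) : r • y ∈ dualCone V := fun x hx hx0 => by
  rw [inner_smul_left]; exact mul_pos hr (hy x hx hx0)

/-- Here no compactness is needed: moving from `x` a fixed distance in direction `-y` stays in the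
open set `V`, and pairing the new point with `y` gives the bound. -/
theorem exists_pos_mul_norm_le_inner_dualCone (ho : IsOpen V)
    {x : EuclideanSpace ℝ (Fin n)} (hx : x ∈ V) :
    ∃ ε : ℝ, 0 < ε ∧ ∀ y ∈ dualCone V, ε * ‖y‖ ≤ inner ℝ x y := by
  obtain ⟨r, hr, hball⟩ := Metric.isOpen_iff.1 ho x hx
  refine ⟨r / 2, half_pos hr, fun y hy => ?_⟩
  rcases eq_or_ne y 0 with rfl | hy0
  · simp
  have hn : 0 < ‖y‖ := norm_pos_iff.2 hy0
  set z := x - (r / 2 * ‖y‖⁻¹) • y with hz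
  have hzV : z ∈ V := by
    apply hball
    rw [Metric.mem_ball, dist_eq_norm, hz, sub_sub_cancel_left, norm_neg, norm_smul,
      Real.norm_of_nonneg (by positivity), mul_assoc, inv_mul_cancel₀ hn.ne']
    linarith
  have h0 : 0 ≤ (inner ℝ y z : ℝ) := by
    rcases eq_or_ne z 0 with h | h
    · simp [h]
    · exact (hy z (subset_closure hzV) h).le
  rw [hz, inner_sub_right, inner_smul_right, real_inner_self_eq_norm_sq, real_inner_comm] at h0
  have : r / 2 * ‖y‖⁻¹ * ‖y‖ ^ 2 = r / 2 * ‖y‖ := by field_simp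
  linarith

end Cone

/-! ### The volume of cone intervals -/

section Delta

variable {n : ℕ} {W : Set (EuclideanSpace ℝ (Fin n))}

theorem coneInterval_matAct {A : Matrix (Fin n) (Fin n) ℝ} (hA : A ∈ coneAut W) (hd : A.det ≠ 0)
    (x : EuclideanSpace ℝ (Fin n)) :
    coneInterval W 0 (matAct A x) = matAct A '' coneInterval W 0 x := by
  have hiff : ∀ z, matAct A z ∈ W ↔ z ∈ W := fun z => by
    refine ⟨fun h => ?_, matAct_mem_of_mem_coneAut hA⟩
    simpa only [matAct_inv_matAct hd] using matAct_mem_of_mem_coneAut (inv_mem_coneAut hA hd) h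
  have hsub : ∀ z w, matAct A (z - w) = matAct A z - matAct A w := fun z w => map_sub _ z w
  ext y
  obtain ⟨y, rfl⟩ : ∃ z, y = matAct A z := ⟨_, (matAct_matAct_inv hd y).symm⟩
  rw [(matAct_injective hd).mem_set_image]
  simp only [coneInterval, Set.mem_ofPred_eq, sub_zero, ← hsub, hiff]

theorem coneDelta_matAct {A : Matrix (Fin n) (Fin n) ℝ} (hA : A ∈ coneAut W) (hd : A.det ≠ 0)
    (x : EuclideanSpace ℝ (Fin n)) :
    coneDelta W (matAct A x) = ENNReal.ofReal |A.det| * coneDelta W x := by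
  rw [coneDelta, coneInterval_matAct hA hd, volume_image_matAct, coneDelta]

theorem measurable_coneDelta (ho : IsOpen W) : Measurable (coneDelta W) := by
  have hS : MeasurableSet {z : EuclideanSpace ℝ (Fin n) × EuclideanSpace ℝ (Fin n) |
      z.2 ∈ W ∧ z.2 - 0 ∈ W ∧ z.1 - z.2 ∈ W} := by
    refine (measurable_snd ho.measurableSet).inter
      (MeasurableSet.inter ?_ ?_)
    · exact (measurable_snd.sub_const 0) ho.measurableSet
    · exact (measurable_fst.sub measurable_snd) ho.measurableSet
  exact measurable_measure_prodMk_left (ν := volume) hS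

theorem coneDelta_pos (ho : IsOpen W) (hs : ∀ x ∈ W, ∀ r : ℝ, 0 < r → r • x ∈ W)
    {x : EuclideanSpace ℝ (Fin n)} (hx : x ∈ W) : 0 < coneDelta W x := by
  have hopen : IsOpen (coneInterval W 0 x) :=
    ho.inter ((ho.preimage (continuous_id.sub continuous_const)).inter
      (ho.preimage (continuous_const.sub continuous_id)))
  refine hopen.measure_pos _ ⟨(1 / 2 : ℝ) • x, ?_⟩
  have h := hs x hx (1 / 2) (by norm_num)
  refine ⟨h, by simpa using h, ?_⟩
  have : x - (1 / 2 : ℝ) • x = (1 / 2 : ℝ) • x := by module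
  rwa [this]

/-- If `y` and `x - y` both lie in `W`, coercivity of `u` gives `ε‖y‖ ≤ ⟪u, x⟫`, so the interval is
bounded. -/
theorem coneDelta_lt_top {u : EuclideanSpace ℝ (Fin n)} {ε : ℝ} (hε : 0 < ε)
    (hu : ∀ y ∈ W, ε * ‖y‖ ≤ inner ℝ u y) (x : EuclideanSpace ℝ (Fin n)) :
    coneDelta W x < ∞ := by
  refine (measure_mono (t := Metric.closedBall 0 (inner ℝ u x / ε)) ?_).trans_lt
    measure_closedBall_lt_top
  rintro y ⟨hy, -, hxy⟩
  have h1 := hu y hy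
  have h2 := hu _ hxy
  rw [inner_sub_right] at h2
  have h3 : 0 ≤ ε * ‖x - y‖ := by positivity
  rw [mem_closedBall_zero_iff, le_div_iff₀ hε]
  linarith

end Delta

/-! ### Homogeneity of the dual cone -/

section Dual

variable {n : ℕ} {V : Set (EuclideanSpace ℝ (Fin n))}

/-- The Laplace transform of the indicator function of `V`. -/
noncomputable def coneLaplace (V : Set (EuclideanSpace ℝ (Fin n)))
    (y : EuclideanSpace ℝ (Fin n)) : ℝ :=
  ∫ x in V, Real.exp (-inner ℝ y x)

/-- The centroid of `V` for the weight `x ↦ exp (-⟪y, x⟫)`. -/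
noncomputable def coneCentroid (V : Set (EuclideanSpace ℝ (Fin n)))
    (y : EuclideanSpace ℝ (Fin n)) : EuclideanSpace ℝ (Fin n) :=
  (coneLaplace V y)⁻¹ • ∫ x in V, Real.exp (-inner ℝ y x) • x

theorem exists_one_add_norm_mul_exp_le (n : ℕ) {ε : ℝ} (hε : 0 < ε) :
    ∃ C : ℝ, ∀ t : ℝ, 0 ≤ t →
      (1 + t) * Real.exp (-(ε * t)) ≤ C * (1 + t) ^ (-((n : ℝ) + 1)) := by
  -- Bound `exp (ε(1 + t))` below by its Taylor term of degree `n + 2`: one power absorbs the factor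
  -- `1 + t`, and the remaining `n + 1` exceed the dimension, as integrability requires.
  set D := ε⁻¹ ^ (n + 2) * ((n + 2).factorial : ℝ) * Real.exp ε
  refine ⟨D, fun t ht => ?_⟩
  have h1 : (0 : ℝ) < 1 + t := by linarith
  have hx : 0 ≤ ε * (1 + t) := by positivity
  have hexp := Real.pow_div_factorial_le_exp _ hx (n + 2)
  have hfac : (0 : ℝ) < (n + 2).factorial := by positivity
  have hrp : (1 + t) ^ (-((n : ℝ) + 1)) = ((1 + t) ^ (n + 1))⁻¹ := by
    rw [Real.rpow_neg h1.le]; norm_cast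
  have he : Real.exp (-(ε * t)) = Real.exp ε * (Real.exp (ε * (1 + t)))⁻¹ := by
    rw [← Real.exp_neg, ← Real.exp_add]; congr 1; ring
  rw [hrp, he]
  have h2 : (Real.exp (ε * (1 + t)))⁻¹ ≤ ((ε * (1 + t)) ^ (n + 2) / (n + 2).factorial)⁻¹ :=
    inv_anti₀ (by positivity) hexp
  calc (1 + t) * (Real.exp ε * (Real.exp (ε * (1 + t)))⁻¹)
      ≤ (1 + t) * (Real.exp ε * ((ε * (1 + t)) ^ (n + 2) / (n + 2).factorial)⁻¹) := by gcongr
    _ = D * ((1 + t) ^ (n + 1))⁻¹ := by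
      simp only [D, mul_pow, inv_pow, inv_div, pow_succ (1 + t) (n + 1)]
      field_simp

theorem integrableOn_one_add_norm_mul_exp (ho : IsOpen V)
    (hs : ∀ x ∈ V, ∀ r : ℝ, 0 < r → r • x ∈ V)
    {y : EuclideanSpace ℝ (Fin n)} (hy : y ∈ dualCone V) :
    IntegrableOn (fun x => (1 + ‖x‖) * Real.exp (-inner ℝ y x)) V := by
  obtain ⟨ε, hε, h⟩ := exists_pos_mul_norm_le_inner hy hs
  obtain ⟨C, hC⟩ := exists_one_add_norm_mul_exp_le n hε
  have hint : Integrable (fun x : EuclideanSpace ℝ (Fin n) =>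
      C * (1 + ‖x‖) ^ (-((n : ℝ) + 1))) :=
    (integrable_one_add_norm (by simp)).const_mul C
  refine Integrable.mono' (hint.integrableOn (s := V)) (by fun_prop) ?_
  refine (ae_restrict_iff' ho.measurableSet).2 (ae_of_all _ fun x hx => ?_)
  rw [Real.norm_of_nonneg (by positivity)]
  refine le_trans ?_ (hC ‖x‖ (norm_nonneg x))
  have := h x (subset_closure hx)
  gcongr

theorem integrableOn_exp_neg_inner (ho : IsOpen V)
    (hs : ∀ x ∈ V, ∀ r : ℝ, 0 < r → r • x ∈ V)
    {y : EuclideanSpace ℝ (Fin n)} (hy : y ∈ dualCone V) :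
    IntegrableOn (fun x => Real.exp (-inner ℝ y x)) V := by
  refine Integrable.mono' (integrableOn_one_add_norm_mul_exp ho hs hy) (by fun_prop)
    (ae_of_all _ fun x => ?_)
  rw [Real.norm_of_nonneg (by positivity)]
  nlinarith [Real.exp_pos (-inner ℝ y x), norm_nonneg x]

theorem integrableOn_exp_neg_inner_smul (ho : IsOpen V)
    (hs : ∀ x ∈ V, ∀ r : ℝ, 0 < r → r • x ∈ V)
    {y : EuclideanSpace ℝ (Fin n)} (hy : y ∈ dualCone V) :
    IntegrableOn (fun x => Real.exp (-inner ℝ y x) • x) V := by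
  refine Integrable.mono' (integrableOn_one_add_norm_mul_exp ho hs hy) (by fun_prop)
    (ae_of_all _ fun x => ?_)
  rw [norm_smul, Real.norm_of_nonneg (by positivity)]
  nlinarith [Real.exp_pos (-inner ℝ y x), norm_nonneg x]

theorem coneLaplace_pos (hne : V.Nonempty) (ho : IsOpen V)
    (hs : ∀ x ∈ V, ∀ r : ℝ, 0 < r → r • x ∈ V)
    {y : EuclideanSpace ℝ (Fin n)} (hy : y ∈ dualCone V) : 0 < coneLaplace V y := by
  refine (setIntegral_pos_iff_support_of_nonneg_ae (ae_of_all _ fun x => by positivity)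
    (integrableOn_exp_neg_inner ho hs hy)).2 ?_
  have : Function.support (fun x => Real.exp (-inner ℝ y x)) = Set.univ := by
    ext x; simp [Real.exp_ne_zero]
  rw [this, Set.univ_inter]
  exact ho.measure_pos _ hne

/-- Substituting `x = Az` leaves the weight's pairing invariant; the Jacobians of numerator and
denominator cancel, leaving one `A` from the vector integrand. -/
theorem coneCentroid_matAct (hne : V.Nonempty) (ho : IsOpen V) {A : Matrix (Fin n) (Fin n) ℝ}
    (hA : A ∈ coneAut V) (y : EuclideanSpace ℝ (Fin n)) :
    coneCentroid V (matAct (Aᵀ)⁻¹ y) = matAct A (coneCentroid V y) := by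
  have hd := det_ne_zero_of_mem_coneAut hne ho hA
  have hd' : |A.det| ≠ 0 := abs_ne_zero.2 hd
  have hZ : coneLaplace V (matAct (Aᵀ)⁻¹ y) = |A.det| * coneLaplace V y := by
    have := integral_image_matAct hd ho.measurableSet
      (fun x => Real.exp (-inner ℝ (matAct (Aᵀ)⁻¹ y) x))
    rw [show matAct A '' V = V from hA] at this
    simpa only [inner_matAct_transpose_inv hd, smul_eq_mul, coneLaplace] using this
  -- An invertible map commutes with the Bochner integral even without integrability, so `y` need
  -- not lie in `V*`.
  let L : EuclideanSpace ℝ (Fin n) ≃L[ℝ] EuclideanSpace ℝ (Fin n) :=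
    (LinearEquiv.ofInjectiveEndo (Matrix.toEuclideanLin A)
      (matAct_injective hd)).toContinuousLinearEquiv
  have hM : ∫ x in V, Real.exp (-inner ℝ (matAct (Aᵀ)⁻¹ y) x) • x =
      |A.det| • matAct A (∫ x in V, Real.exp (-inner ℝ y x) • x) := by
    have := integral_image_matAct hd ho.measurableSet
      (fun x => Real.exp (-inner ℝ (matAct (Aᵀ)⁻¹ y) x) • x)
    rw [show matAct A '' V = V from hA] at this
    rw [this]
    simp only [inner_matAct_transpose_inv hd]
    congr 1
    have h2 := L.integral_comp_comm (μ := volume.restrict V)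
      (fun x => Real.exp (-inner ℝ y x) • x)
    refine Eq.trans ?_ h2
    refine integral_congr_ae (ae_of_all _ fun x => ?_)
    exact (map_smul (Matrix.toEuclideanLin A) _ x).symm
  rw [coneCentroid, coneCentroid, hZ, hM, smul_smul]
  refine Eq.trans ?_ (map_smul (Matrix.toEuclideanLin A) _ _).symm
  congr 1
  field_simp

theorem clm_apply_coneCentroid (ho : IsOpen V) (hs : ∀ x ∈ V, ∀ r : ℝ, 0 < r → r • x ∈ V)
    {y : EuclideanSpace ℝ (Fin n)} (hy : y ∈ dualCone V)
    (ℓ : EuclideanSpace ℝ (Fin n) →L[ℝ] ℝ) :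
    ℓ (coneCentroid V y) =
      ∫ x in V, (coneLaplace V y)⁻¹ * Real.exp (-inner ℝ y x) * ℓ x := by
  rw [coneCentroid, map_smul,
    ← ℓ.integral_comp_comm (integrableOn_exp_neg_inner_smul ho hs hy), smul_eq_mul,
    ← integral_const_mul]
  simp [mul_assoc]

/-- Otherwise Hahn–Banach gives `ℓ < ℓ c` on the open convex set `V`, where `c` is the centroid;
averaging against the probability density yields `ℓ c < ℓ c`. -/
theorem coneCentroid_mem (hV : IsOpenCone V) {y : EuclideanSpace ℝ (Fin n)}
    (hy : y ∈ dualCone V) : coneCentroid V y ∈ V := by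
  by_contra hc
  have ho := hV.isOpen
  have hconv : Convex ℝ V := by
    refine convex_iff_forall_pos.2 fun x hx z hz a b ha hb _ => ?_
    exact hV.add_mem _ (hV.smul_mem x hx a ha) _ (hV.smul_mem z hz b hb)
  obtain ⟨ℓ, hℓ⟩ := geometric_hahn_banach_open_point hconv ho hc
  have hZ := coneLaplace_pos hV.nonempty ho hV.smul_mem hy
  set Z := coneLaplace V y with hZdef
  have h1 := clm_apply_coneCentroid ho hV.smul_mem hy ℓ
  set c := coneCentroid V y
  have hi1 : IntegrableOn (fun x => Z⁻¹ * Real.exp (-inner ℝ y x) * ℓ c) V :=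
    ((integrableOn_exp_neg_inner ho hV.smul_mem hy).const_mul _).mul_const _
  have hi2 : IntegrableOn (fun x => Z⁻¹ * Real.exp (-inner ℝ y x) * ℓ x) V := by
    have := (ℓ.integrable_comp (integrableOn_exp_neg_inner_smul ho hV.smul_mem hy)).const_mul Z⁻¹
    simpa [mul_assoc, IntegrableOn] using this
  have h2 : ∫ x in V, Z⁻¹ * Real.exp (-inner ℝ y x) * ℓ c = ℓ c := by
    rw [integral_mul_const, integral_const_mul, ← coneLaplace, ← hZdef, inv_mul_cancel₀ hZ.ne',
      one_mul]
  have hpos : 0 < ∫ x in V, (Z⁻¹ * Real.exp (-inner ℝ y x) * ℓ c -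
      Z⁻¹ * Real.exp (-inner ℝ y x) * ℓ x) := by
    have hkey : ∀ x ∈ V, 0 < Z⁻¹ * Real.exp (-inner ℝ y x) * ℓ c -
        Z⁻¹ * Real.exp (-inner ℝ y x) * ℓ x := fun x hx => by
      rw [← mul_sub]
      have := sub_pos.2 (hℓ x hx)
      positivity
    refine (setIntegral_pos_iff_support_of_nonneg_ae ?_ (hi1.sub hi2)).2 ?_
    · exact (ae_restrict_iff' ho.measurableSet).2 (ae_of_all _ fun x hx => (hkey x hx).le)
    · refine (ho.measure_pos volume hV.nonempty).trans_le (measure_mono fun x hx => ⟨?_, hx⟩)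
      exact (hkey x hx).ne'
  rw [integral_sub hi1 hi2, h2, ← h1] at hpos
  linarith

theorem sub_mul_log_sub_log_nonneg {a b : ℝ} (ha : 0 < a) (hb : 0 < b) :
    0 ≤ (a - b) * (Real.log a - Real.log b) := by
  rcases le_total a b with h | h
  · exact mul_nonneg_of_nonpos_of_nonpos (sub_nonpos.2 h)
      (sub_nonpos.2 (Real.log_le_log ha h))
  · exact mul_nonneg (sub_nonneg.2 h) (sub_nonneg.2 (Real.log_le_log hb h))

/-- A symmetrised relative entropy argument. The normalised densities `g y₁`, `g y₂` have log-ratio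
`ℓ + κ`, which is affine, so equal centroids give it equal means. Hence the nonnegative function `(g
y₁ - g y₂)(log g y₁ - log g y₂)` has integral zero and vanishes on `V`, forcing `ℓ + κ = 0` there.
-/
theorem coneCentroid_injOn (hV : IsOpenCone V) : Set.InjOn (coneCentroid V) (dualCone V) := by
  intro y₁ h₁ y₂ h₂ heq
  have ho := hV.isOpen
  have hs := hV.smul_mem
  set ℓ : EuclideanSpace ℝ (Fin n) →L[ℝ] ℝ := innerSL ℝ (y₂ - y₁) with hℓ
  have e₁ := clm_apply_coneCentroid ho hs h₁ ℓ
  have e₂ := clm_apply_coneCentroid ho hs h₂ ℓ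
  have hone : ∀ y ∈ dualCone V,
      ∫ x in V, (coneLaplace V y)⁻¹ * Real.exp (-inner ℝ y x) = 1 := fun y hy => by
    rw [integral_const_mul, ← coneLaplace,
      inv_mul_cancel₀ (coneLaplace_pos hV.nonempty ho hs hy).ne']
  have i₁ : ∀ y ∈ dualCone V,
      IntegrableOn (fun x => (coneLaplace V y)⁻¹ * Real.exp (-inner ℝ y x)) V := fun y hy =>
    (integrableOn_exp_neg_inner ho hs hy).const_mul _
  have i₂ : ∀ y ∈ dualCone V,
      IntegrableOn (fun x => (coneLaplace V y)⁻¹ * Real.exp (-inner ℝ y x) * ℓ x) V :=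
    fun y hy => by
      have := (ℓ.integrable_comp (integrableOn_exp_neg_inner_smul ho hs hy)).const_mul
        (coneLaplace V y)⁻¹
      simpa [mul_assoc, IntegrableOn] using this
  set g : EuclideanSpace ℝ (Fin n) → EuclideanSpace ℝ (Fin n) → ℝ :=
    fun y x => (coneLaplace V y)⁻¹ * Real.exp (-inner ℝ y x) with hg
  have hlog : ∀ y ∈ dualCone V, ∀ x,
      Real.log (g y x) = -Real.log (coneLaplace V y) - inner ℝ y x := fun y hy x => by
    have := (coneLaplace_pos hV.nonempty ho hs hy).ne'
    rw [hg, Real.log_mul (by positivity) (by positivity), Real.log_exp, Real.log_inv]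
    ring
  set κ := Real.log (coneLaplace V y₂) - Real.log (coneLaplace V y₁) with hκ
  set h : EuclideanSpace ℝ (Fin n) → ℝ := fun x => (g y₁ x - g y₂ x) * (ℓ x + κ) with hh
  have hlogdiff : ∀ x, Real.log (g y₁ x) - Real.log (g y₂ x) = ℓ x + κ := fun x => by
    rw [hlog _ h₁, hlog _ h₂, hκ, hℓ, innerSL_apply_apply, inner_sub_left]
    ring
  have gpos : ∀ y ∈ dualCone V, ∀ x, 0 < g y x := fun y hy x => by
    have := coneLaplace_pos hV.nonempty ho hs hy
    simp only [hg]; positivity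
  have hnonneg : ∀ x, 0 ≤ h x := fun x => by
    simp only [hh, ← hlogdiff]
    exact sub_mul_log_sub_log_nonneg (gpos _ h₁ x) (gpos _ h₂ x)
  have hexp : h = fun x => (g y₁ x * ℓ x - g y₂ x * ℓ x) + (g y₁ x * κ - g y₂ x * κ) := by
    funext x; simp only [hh]; ring
  have hint : IntegrableOn h V := by
    rw [hexp]
    exact ((i₂ _ h₁).sub (i₂ _ h₂)).add (((i₁ _ h₁).mul_const κ).sub ((i₁ _ h₂).mul_const κ))
  have hzero : ∫ x in V, h x = 0 := by
    have hsplit : ∫ x in V, h x =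
        ∫ x in V, ((g y₁ x * ℓ x - g y₂ x * ℓ x) + (g y₁ x * κ - g y₂ x * κ)) := by rw [hexp]
    have hadd := integral_add ((i₂ _ h₁).sub (i₂ _ h₂))
      (((i₁ _ h₁).mul_const κ).sub ((i₁ _ h₂).mul_const κ))
    simp only [Pi.sub_apply] at hadd
    rw [hsplit, hadd,
      integral_sub (i₂ _ h₁) (i₂ _ h₂),
      integral_sub ((i₁ _ h₁).mul_const κ) ((i₁ _ h₂).mul_const κ),
      integral_mul_const, integral_mul_const, hone _ h₁, hone _ h₂, ← e₁, ← e₂, heq]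
    ring
  have hae : h =ᵐ[volume.restrict V] 0 :=
    (setIntegral_eq_zero_iff_of_nonneg_ae (ae_of_all _ hnonneg) hint).1 hzero
  have hcont : Continuous h := by
    simp only [hh, hg]; fun_prop
  have hall : Set.EqOn h 0 V :=
    Measure.eqOn_open_of_ae_eq hae ho hcont.continuousOn continuousOn_const
  have hℓκ : ∀ x ∈ V, ℓ x + κ = 0 := fun x hx => by
    rcases mul_eq_zero.1 (hall hx) with h0 | h0
    · rw [← hlogdiff, sub_eq_zero.1 h0, sub_self]
    · exact h0
  -- Comparing `x` with `2x` separates the linear part from the constant.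
  have hℓ0 : ∀ x ∈ V, ℓ x = 0 := fun x hx => by
    have a := hℓκ x hx
    have b := hℓκ _ (hs x hx 2 two_pos)
    rw [map_smul, smul_eq_mul] at b
    linarith
  obtain ⟨x, hx⟩ := hV.nonempty
  obtain ⟨r, hr, hball⟩ := Metric.isOpen_iff.1 ho x hx
  set w := y₂ - y₁
  -- Small enough that `x + t • w` stays in the ball; the `+ 1` covers `w = 0`.
  set t : ℝ := r / (2 * (‖w‖ + 1)) with ht
  have hw : 0 < ‖w‖ + 1 := by positivity
  have ht0 : 0 < t := by positivity
  have hmem : x + t • w ∈ V := by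
    apply hball
    rw [Metric.mem_ball, dist_eq_norm, add_sub_cancel_left, norm_smul,
      Real.norm_of_nonneg ht0.le, ht, div_mul_eq_mul_div, div_lt_iff₀ (by positivity)]
    nlinarith [norm_nonneg w]
  have h3 := hℓ0 _ hmem
  rw [map_add, hℓ0 x hx, zero_add, map_smul, smul_eq_mul, hℓ, innerSL_apply_apply,
    mul_eq_zero, inner_self_eq_zero] at h3
  exact (sub_eq_zero.1 (h3.resolve_left ht0.ne')).symm

/-- An `A` matching the centroids of `x` and `y` must match the points themselves, by equivariance
and injectivity. -/
theorem IsHomogeneousCone.dualCone_transitive (hV : IsHomogeneousCone V) :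
    ∀ x ∈ dualCone V, ∀ y ∈ dualCone V, ∃ A ∈ coneAut V, y = matAct (Aᵀ)⁻¹ x := by
  intro x hx y hy
  obtain ⟨A, hA, h⟩ := hV.transitive _ (coneCentroid_mem hV.toIsOpenCone hx) _
    (coneCentroid_mem hV.toIsOpenCone hy)
  have hd := det_ne_zero_of_mem_coneAut hV.nonempty hV.isOpen hA
  refine ⟨A, hA, coneCentroid_injOn hV.toIsOpenCone hy ?_ ?_⟩
  · exact matAct_mem_of_mem_coneAut (transpose_inv_mem_coneAut_dualCone hA hd) hx
  · rw [h, coneCentroid_matAct hV.nonempty hV.isOpen hA]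

end Dual

/-! ### A Schur test with weights -/

section Schur

variable {X Y : Type*} [MeasurableSpace X] [MeasurableSpace Y]

theorem AEMeasurable.ae_aemeasurable_section {μ : Measure X} {ν : Measure Y} [SFinite ν]
    {k : X → Y → ℝ≥0∞} (hk : AEMeasurable (Function.uncurry k) (μ.prod ν)) :
    ∀ᵐ x ∂μ, AEMeasurable (k x) ν := by
  filter_upwards [Measure.ae_ae_of_ae_prod hk.ae_eq_mk] with x hx
  exact ⟨fun y => hk.mk _ (x, y), hk.measurable_mk.comp measurable_prodMk_left, hx⟩

/-- Hölder applied to `κ f = (κ f^p E^(-δ(p-1)))^(1/p) (κ E^δ)^(1-1/p)`; this form includes `p = 1`.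
-/
theorem lintegral_kernel_le {ν : Measure Y} {κ f E : Y → ℝ≥0∞} (hκ : AEMeasurable κ ν)
    (hf : AEMeasurable f ν) (hE : AEMeasurable E ν) (hE0 : ∀ᵐ y ∂ν, E y ≠ 0 ∧ E y ≠ ∞)
    {p : ℝ} (hp : 1 ≤ p) (δ : ℝ) :
    ∫⁻ y, κ y * f y ∂ν ≤ (∫⁻ y, κ y * (f y ^ p * E y ^ (-(δ * (p - 1)))) ∂ν) ^ (1 / p) *
      (∫⁻ y, κ y * E y ^ δ ∂ν) ^ (1 - 1 / p) := by
  have hp0 : 0 < p := by linarith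
  have hp1 : 0 ≤ 1 - 1 / p := by rw [sub_nonneg, div_le_one hp0]; exact hp
  refine le_trans (le_of_eq ?_) (ENNReal.lintegral_mul_norm_pow_le
    (hκ.mul ((hf.pow_const p).mul (hE.pow_const _))) (hκ.mul (hE.pow_const δ))
    (p := 1 / p) (q := 1 - 1 / p) (by positivity) hp1 (by ring))
  refine lintegral_congr_ae (hE0.mono fun y hy => ?_)
  have hk : κ y ^ (1 / p) * κ y ^ (1 - 1 / p) = κ y := by
    rw [← ENNReal.rpow_add_of_nonneg _ _ (by positivity) hp1, add_sub_cancel, ENNReal.rpow_one]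
  have hEE : E y ^ (-(δ * (p - 1)) * (1 / p)) * E y ^ (δ * (1 - 1 / p)) = 1 := by
    rw [← ENNReal.rpow_add _ _ hy.1 hy.2,
      show -(δ * (p - 1)) * (1 / p) + δ * (1 - 1 / p) = 0 by field_simp; ring, ENNReal.rpow_zero]
  simp only [Pi.mul_apply]
  rw [ENNReal.mul_rpow_of_nonneg _ _ (by positivity : 0 ≤ 1 / p),
    ENNReal.mul_rpow_of_nonneg _ _ (by positivity : 0 ≤ 1 / p),
    ENNReal.mul_rpow_of_nonneg _ _ hp1, ← ENNReal.rpow_mul, ← ENNReal.rpow_mul,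
    ← ENNReal.rpow_mul, mul_one_div_cancel hp0.ne', ENNReal.rpow_one]
  calc κ y * f y = (κ y ^ (1 / p) * κ y ^ (1 - 1 / p)) * f y *
        (E y ^ (-(δ * (p - 1)) * (1 / p)) * E y ^ (δ * (1 - 1 / p))) := by
        rw [hk, hEE, mul_one]
    _ = _ := by ring

/-- This is the bound Minkowski's integral inequality would give. It follows from Hölder against the
measure `g E^(e/r) dν` of total mass `M`, then Tonelli: the density `m` is chosen so that `E^(-e)`
cancels the bound on the inner integral. -/
theorem lintegral_kernel_rpow_le {μ : Measure X} {ν : Measure Y} [SFinite μ] [SFinite ν]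
    {k : X → Y → ℝ≥0∞} (hk : AEMeasurable (Function.uncurry k) (μ.prod ν))
    {w : X → ℝ≥0∞} (hw : AEMeasurable w μ) {g E : Y → ℝ≥0∞} (hg : AEMeasurable g ν)
    (hE : AEMeasurable E ν) (hE0 : ∀ᵐ y ∂ν, E y ≠ 0 ∧ E y ≠ ∞) {r : ℝ} (hr : 1 ≤ r) (e : ℝ)
    {C : ℝ≥0∞} (h : ∀ᵐ y ∂ν, ∫⁻ x, k x y ^ r * w x ∂μ ≤ C * E y ^ e) :
    ∫⁻ x, (∫⁻ y, k x y * g y ∂ν) ^ r * w x ∂μ ≤ C * (∫⁻ y, g y * E y ^ (e / r) ∂ν) ^ r := by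
  have hr0 : 0 < r := by linarith
  have hr1 : 0 ≤ 1 - 1 / r := by rw [sub_nonneg, div_le_one hr0]; exact hr
  set M := ∫⁻ y, g y * E y ^ (e / r) ∂ν with hM
  set m : Y → ℝ≥0∞ := fun y => E y ^ (-e) * (g y * E y ^ (e / r)) with hm
  have hgE : AEMeasurable (fun y => g y * E y ^ (e / r)) ν := hg.mul (hE.pow_const _)
  have hmm : AEMeasurable m ν := (hE.pow_const _).mul hgE
  have hprod : AEMeasurable (Function.uncurry fun x y => k x y ^ r * w x * m y) (μ.prod ν) :=
    ((hk.pow_const r).mul hw.comp_fst).mul hmm.comp_snd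
  have hsec : ∀ᵐ x ∂μ, AEMeasurable (k x) ν := hk.ae_aemeasurable_section
  have hpt : ∀ᵐ x ∂μ, (∫⁻ y, k x y * g y ∂ν) ^ r * w x ≤
      (∫⁻ y, k x y ^ r * w x * m y ∂ν) * M ^ (r - 1) := by
    filter_upwards [hsec] with x hx
    have hle : ∫⁻ y, k x y * g y ∂ν ≤ (∫⁻ y, k x y ^ r * m y ∂ν) ^ (1 / r) * M ^ (1 - 1 / r) := by
      refine le_trans (le_of_eq ?_) (ENNReal.lintegral_mul_norm_pow_le
        ((hx.pow_const r).mul hmm) hgE (p := 1 / r) (q := 1 - 1 / r) (by positivity) hr1 (by ring))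
      refine lintegral_congr_ae (hE0.mono fun y hy => ?_)
      have hgg : (g y * E y ^ (e / r)) ^ (1 / r) * (g y * E y ^ (e / r)) ^ (1 - 1 / r) =
          g y * E y ^ (e / r) := by
        rw [← ENNReal.rpow_add_of_nonneg _ _ (by positivity) hr1, add_sub_cancel,
          ENNReal.rpow_one]
      have hEE : E y ^ (-e * (1 / r)) * E y ^ (e / r) = 1 := by
        rw [← ENNReal.rpow_add _ _ hy.1 hy.2, show -e * (1 / r) + e / r = 0 by ring,
          ENNReal.rpow_zero]
      simp only [hm, Pi.mul_apply]
      rw [ENNReal.mul_rpow_of_nonneg _ _ (by positivity : 0 ≤ 1 / r),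
        ENNReal.mul_rpow_of_nonneg _ _ (by positivity : 0 ≤ 1 / r), ← ENNReal.rpow_mul,
        mul_one_div_cancel hr0.ne', ENNReal.rpow_one, ← ENNReal.rpow_mul, mul_assoc, mul_assoc,
        hgg, mul_left_comm (E y ^ (-e * (1 / r))), hEE, mul_one]
    have hwx : ∫⁻ y, k x y ^ r * w x * m y ∂ν = (∫⁻ y, k x y ^ r * m y ∂ν) * w x := by
      refine Eq.trans (lintegral_congr fun y => ?_)
        (lintegral_mul_const'' (w x) ((hx.pow_const r).mul hmm))
      exact mul_right_comm _ _ _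
    calc (∫⁻ y, k x y * g y ∂ν) ^ r * w x
        ≤ ((∫⁻ y, k x y ^ r * m y ∂ν) ^ (1 / r) * M ^ (1 - 1 / r)) ^ r * w x := by gcongr
      _ = (∫⁻ y, k x y ^ r * w x * m y ∂ν) * M ^ (r - 1) := by
        rw [ENNReal.mul_rpow_of_nonneg _ _ hr0.le, ← ENNReal.rpow_mul, ← ENNReal.rpow_mul,
          one_div_mul_cancel hr0.ne', ENNReal.rpow_one,
          show (1 - 1 / r) * r = r - 1 by field_simp, hwx]
        ring
  have hin : ∀ᵐ y ∂ν, ∫⁻ x, k x y ^ r * w x * m y ∂μ ≤ C * (g y * E y ^ (e / r)) := by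
    have hsec' : ∀ᵐ y ∂ν, AEMeasurable (fun x => k x y) μ :=
      AEMeasurable.ae_aemeasurable_section (k := fun y x => k x y) hk.prod_swap
    filter_upwards [hsec', h, hE0] with y hy hCy hEy
    refine (lintegral_mul_const'' (m y) ((hy.pow_const r).mul hw)).trans_le ?_
    have hEE : E y ^ e * E y ^ (-e) = 1 := by
      rw [← ENNReal.rpow_add _ _ hEy.1 hEy.2, add_neg_cancel, ENNReal.rpow_zero]
    calc (∫⁻ x, k x y ^ r * w x ∂μ) * m y ≤ C * E y ^ e * m y := by gcongr
      _ = C * (g y * E y ^ (e / r)) * (E y ^ e * E y ^ (-e)) := by simp only [hm]; ring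
      _ = _ := by rw [hEE, mul_one]
  calc ∫⁻ x, (∫⁻ y, k x y * g y ∂ν) ^ r * w x ∂μ
      ≤ ∫⁻ x, (∫⁻ y, k x y ^ r * w x * m y ∂ν) * M ^ (r - 1) ∂μ := lintegral_mono_ae hpt
    _ = (∫⁻ y, ∫⁻ x, k x y ^ r * w x * m y ∂μ ∂ν) * M ^ (r - 1) := by
      rw [← lintegral_lintegral_swap hprod]
      exact lintegral_mul_const'' _ hprod.lintegral_prod_right'
    _ ≤ (∫⁻ y, C * (g y * E y ^ (e / r)) ∂ν) * M ^ (r - 1) := by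
      gcongr ?_ * _
      exact lintegral_mono_ae hin
    _ = C * M ^ r := by
      rw [lintegral_const_mul'' _ hgE, ← hM, mul_assoc]
      congr 1
      nth_rewrite 1 [← ENNReal.rpow_one M]
      rw [← ENNReal.rpow_add_of_nonneg _ _ zero_le_one (by linarith), add_sub_cancel]

/-- Hölder in `y` uses `h₁` and leaves an `L^(q/p)` estimate for `g`, supplied by `h₂`. The exponent
of `D` in `h₂` is `u` corrected by the power `-s` raised to `q(1 - 1/p)`. -/
theorem weighted_schur_test {μ : Measure X} {ν : Measure Y} [SFinite μ] [SFinite ν]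
    {k : X → Y → ℝ≥0∞} (hk : AEMeasurable (Function.uncurry k) (μ.prod ν))
    {D : X → ℝ≥0∞} (hD : AEMeasurable D μ) (hD0 : ∀ᵐ x ∂μ, D x ≠ 0 ∧ D x ≠ ∞)
    {E : Y → ℝ≥0∞} (hE : AEMeasurable E ν) (hE0 : ∀ᵐ y ∂ν, E y ≠ 0 ∧ E y ≠ ∞)
    {p q : ℝ} (hp : 1 ≤ p) (hpq : p ≤ q) {δ s e u : ℝ} {C₁ C₂ : ℝ≥0}
    (h₁ : ∀ᵐ x ∂μ, ∫⁻ y, k x y * E y ^ δ ∂ν ≤ C₁ * D x ^ (-s))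
    (h₂ : ∀ᵐ y ∂ν, ∫⁻ x, k x y ^ (q / p) * D x ^ (u - s * (q * (1 - 1 / p))) ∂μ ≤ C₂ * E y ^ e)
    {f : Y → ℝ≥0∞} (hf : AEMeasurable f ν) :
    (∫⁻ x, (∫⁻ y, k x y * f y ∂ν) ^ q * D x ^ u ∂μ) ^ (1 / q) ≤
      (C₁ ^ (1 - 1 / p) * C₂ ^ (1 / q) : ℝ≥0) *
        (∫⁻ y, f y ^ p * E y ^ (-(δ * (p - 1)) + e / (q / p)) ∂ν) ^ (1 / p) := by
  have hp0 : 0 < p := by linarith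
  have hq0 : 0 < q := by linarith
  have hp1 : 0 ≤ 1 - 1 / p := by rw [sub_nonneg, div_le_one hp0]; exact hp
  have hr : 1 ≤ q / p := (one_le_div hp0).2 hpq
  set g : Y → ℝ≥0∞ := fun y => f y ^ p * E y ^ (-(δ * (p - 1))) with hg
  set t := u - s * (q * (1 - 1 / p)) with ht
  have hgm : AEMeasurable g ν := (hf.pow_const p).mul (hE.pow_const _)
  have hM : ∫⁻ y, g y * E y ^ (e / (q / p)) ∂ν =
      ∫⁻ y, f y ^ p * E y ^ (-(δ * (p - 1)) + e / (q / p)) ∂ν := by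
    refine lintegral_congr_ae (hE0.mono fun y hy => ?_)
    simp only [hg]
    rw [ENNReal.rpow_add _ _ hy.1 hy.2, mul_assoc]
  have hG := lintegral_kernel_rpow_le hk (hD.pow_const t) hgm hE hE0 hr e h₂
  rw [hM] at hG
  set M := ∫⁻ y, f y ^ p * E y ^ (-(δ * (p - 1)) + e / (q / p)) ∂ν
  have hq1 : 0 ≤ q * (1 - 1 / p) := mul_nonneg hq0.le hp1
  have hpt : ∀ᵐ x ∂μ, (∫⁻ y, k x y * f y ∂ν) ^ q * D x ^ u ≤
      (C₁ : ℝ≥0∞) ^ (q * (1 - 1 / p)) * ((∫⁻ y, k x y * g y ∂ν) ^ (q / p) * D x ^ t) := by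
    have hsec : ∀ᵐ x ∂μ, AEMeasurable (k x) ν := hk.ae_aemeasurable_section
    filter_upwards [hsec, h₁, hD0] with x hx h1x hDx
    have hle := lintegral_kernel_le hx hf hE hE0 hp δ
    calc (∫⁻ y, k x y * f y ∂ν) ^ q * D x ^ u
        ≤ ((∫⁻ y, k x y * g y ∂ν) ^ (1 / p) * (C₁ * D x ^ (-s)) ^ (1 - 1 / p)) ^ q *
            D x ^ u := by
          refine mul_le_mul_left (ENNReal.rpow_le_rpow (hle.trans ?_) hq0.le) _
          exact mul_le_mul_right (ENNReal.rpow_le_rpow h1x hp1) _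
      _ = (C₁ : ℝ≥0∞) ^ (q * (1 - 1 / p)) * ((∫⁻ y, k x y * g y ∂ν) ^ (q / p) *
            (D x ^ (-s * (q * (1 - 1 / p))) * D x ^ u)) := by
          rw [ENNReal.mul_rpow_of_nonneg _ _ hq0.le, ← ENNReal.rpow_mul, ← ENNReal.rpow_mul,
            mul_comm (1 - 1 / p) q, ENNReal.mul_rpow_of_nonneg _ _ hq1, ← ENNReal.rpow_mul,
            one_div_mul_eq_div]
          ring
      _ = _ := by
          rw [← ENNReal.rpow_add _ _ hDx.1 hDx.2, ht,
            show -s * (q * (1 - 1 / p)) + u = u - s * (q * (1 - 1 / p)) by ring]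
  have hC : (C₁ : ℝ≥0∞) ^ (q * (1 - 1 / p)) ≠ ∞ :=
    ENNReal.rpow_ne_top_of_nonneg hq1 ENNReal.coe_ne_top
  calc (∫⁻ x, (∫⁻ y, k x y * f y ∂ν) ^ q * D x ^ u ∂μ) ^ (1 / q)
      ≤ ((C₁ : ℝ≥0∞) ^ (q * (1 - 1 / p)) * (C₂ * M ^ (q / p))) ^ (1 / q) := by
        refine ENNReal.rpow_le_rpow ((lintegral_mono_ae hpt).trans ?_) (by positivity)
        rw [lintegral_const_mul' _ _ hC]
        gcongr
    _ = _ := by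
        have hq' : 0 ≤ 1 / q := by positivity
        rw [ENNReal.mul_rpow_of_nonneg _ _ hq', ENNReal.mul_rpow_of_nonneg _ _ hq',
          ← ENNReal.rpow_mul, ← ENNReal.rpow_mul, ENNReal.coe_mul,
          ENNReal.coe_rpow_of_nonneg _ hp1, ENNReal.coe_rpow_of_nonneg _ hq',
          show q * (1 - 1 / p) * (1 / q) = 1 - 1 / p by field_simp,
          show q / p * (1 / q) = 1 / p by field_simp, mul_assoc]

end Schur

/-! ### Homogeneous functions on homogeneous cones -/

section Homogeneous

theorem exists_eq_const_mul_rpow {α : Type*} {W : Set α} {D F : α → ℝ≥0∞} {e : ℝ}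
    (hD : ∀ x ∈ W, D x ≠ 0 ∧ D x ≠ ∞) (hF : ∀ x ∈ W, F x ≠ ∞)
    (h : ∀ x ∈ W, ∀ y ∈ W, ∃ d : ℝ≥0∞, d ≠ 0 ∧ d ≠ ∞ ∧ D y = d * D x ∧ F y = d ^ e * F x) :
    ∃ C : ℝ≥0, ∀ y ∈ W, F y = C * D y ^ e := by
  rcases W.eq_empty_or_nonempty with rfl | ⟨x, hx⟩
  · exact ⟨0, by simp⟩
  obtain ⟨h0, h1⟩ := hD x hx
  have hC : F x * D x ^ (-e) ≠ ∞ :=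
    ENNReal.mul_ne_top (hF x hx) (by simp [ENNReal.rpow_eq_top_iff, h0, h1])
  refine ⟨(F x * D x ^ (-e)).toNNReal, fun y hy => ?_⟩
  obtain ⟨d, hd0, hd1, hDy, hFy⟩ := h x hx y hy
  rw [ENNReal.coe_toNNReal hC, hDy, hFy, ENNReal.mul_rpow_of_ne_top hd1 h1]
  have : D x ^ (-e) * D x ^ e = 1 := by
    rw [← ENNReal.rpow_add _ _ h0 h1, neg_add_cancel, ENNReal.rpow_zero]
  calc d ^ e * F x = F x * d ^ e * (D x ^ (-e) * D x ^ e) := by rw [this]; ring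
    _ = _ := by ring

variable {n : ℕ} {V : Set (EuclideanSpace ℝ (Fin n))}
  {k : EuclideanSpace ℝ (Fin n) → EuclideanSpace ℝ (Fin n) → ℝ≥0} {β : ℝ}

theorem IsDualHomogeneousKernel.coe_eq (hk : IsDualHomogeneousKernel V k β)
    {A : Matrix (Fin n) (Fin n) ℝ} (hA : A ∈ coneAut V) (hd : A.det ≠ 0)
    {x y : EuclideanSpace ℝ (Fin n)} (hx : x ∈ dualCone V) (hy : y ∈ V) :
    (k (matAct (Aᵀ)⁻¹ x) (matAct A y) : ℝ≥0∞) =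
      ENNReal.ofReal |A.det| ^ β * (k x y : ℝ≥0∞) := by
  rw [ENNReal.ofReal_rpow_of_pos (abs_pos.2 hd), ← ENNReal.ofReal_coe_nnreal, hk A hA x hx y hy,
    ENNReal.ofReal_mul (by positivity), ENNReal.ofReal_coe_nnreal]

theorem ofReal_abs_det_ne {A : Matrix (Fin n) (Fin n) ℝ} (hd : A.det ≠ 0) :
    ENNReal.ofReal |A.det| ≠ 0 ∧ ENNReal.ofReal |A.det| ≠ ∞ :=
  ⟨(ENNReal.ofReal_pos.2 (abs_pos.2 hd)).ne', ENNReal.ofReal_ne_top⟩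

theorem ofReal_abs_det_transpose_inv {A : Matrix (Fin n) (Fin n) ℝ} (hd : A.det ≠ 0) :
    ENNReal.ofReal |((Aᵀ)⁻¹).det| = (ENNReal.ofReal |A.det|)⁻¹ := by
  rw [det_transpose_inv, abs_inv, ENNReal.ofReal_inv_of_pos (abs_pos.2 hd)]

/-- Under `y = Az` the factors `Δ^δ`, `k` and the Jacobian contribute `δ`, `β` and `1` to the
exponent. -/
theorem IsDualHomogeneousKernel.lintegral_left (hV : IsOpenCone V)
    (hk : IsDualHomogeneousKernel V k β) {A : Matrix (Fin n) (Fin n) ℝ} (hA : A ∈ coneAut V)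
    {x : EuclideanSpace ℝ (Fin n)} (hx : x ∈ dualCone V) (δ : ℝ) :
    ∫⁻ y in V, (k (matAct (Aᵀ)⁻¹ x) y : ℝ≥0∞) * coneDelta V y ^ δ =
      ENNReal.ofReal |A.det| ^ (δ + β + 1) * ∫⁻ y in V, (k x y : ℝ≥0∞) * coneDelta V y ^ δ := by
  have hd := det_ne_zero_of_mem_coneAut hV.nonempty hV.isOpen hA
  obtain ⟨ha0, ha1⟩ := ofReal_abs_det_ne hd
  have h := lintegral_image_matAct hd hV.isOpen.measurableSet
    (fun y => (k (matAct (Aᵀ)⁻¹ x) y : ℝ≥0∞) * coneDelta V y ^ δ)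
  rw [show matAct A '' V = V from hA] at h
  set a := ENNReal.ofReal |A.det|
  have hc : a ^ (δ + β) ≠ ∞ := by simp [ENNReal.rpow_eq_top_iff, ha0, ha1]
  rw [h, ENNReal.rpow_add _ _ ha0 ha1, ENNReal.rpow_one, mul_comm _ a, mul_assoc,
    ← lintegral_const_mul' _ _ hc]
  congr 1
  refine setLIntegral_congr_fun hV.isOpen.measurableSet fun y hy => ?_
  rw [hk.coe_eq hA hd hx hy, coneDelta_matAct hA hd, ENNReal.rpow_add _ _ ha0 ha1]
  have : (a * coneDelta V y) ^ δ = a ^ δ * coneDelta V y ^ δ := by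
    rw [ENNReal.mul_rpow_of_ne_zero ha0 (coneDelta_pos hV.isOpen hV.smul_mem hy).ne']
  rw [this]
  ring

/-- Under `x = (Aᵀ)⁻¹z` the kernel contributes `βr`, while `Δ^t` and the Jacobian see the inverse
determinant and contribute `-t` and `-1`. -/
theorem IsDualHomogeneousKernel.lintegral_right (hV : IsOpenCone V)
    (hk : IsDualHomogeneousKernel V k β) {A : Matrix (Fin n) (Fin n) ℝ} (hA : A ∈ coneAut V)
    {y : EuclideanSpace ℝ (Fin n)} (hy : y ∈ V) {r : ℝ} (hr : 0 ≤ r) (t : ℝ) :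
    ∫⁻ x in dualCone V, (k x (matAct A y) : ℝ≥0∞) ^ r * coneDelta (dualCone V) x ^ t =
      ENNReal.ofReal |A.det| ^ (β * r - t - 1) *
        ∫⁻ x in dualCone V, (k x y : ℝ≥0∞) ^ r * coneDelta (dualCone V) x ^ t := by
  have hd := det_ne_zero_of_mem_coneAut hV.nonempty hV.isOpen hA
  obtain ⟨ha0, ha1⟩ := ofReal_abs_det_ne hd
  have hB := transpose_inv_mem_coneAut_dualCone hA hd
  have hdB : ((Aᵀ)⁻¹).det ≠ 0 := by rw [det_transpose_inv]; exact inv_ne_zero hd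
  have ho : IsOpen (dualCone V) := isOpen_dualCone hV.smul_mem
  have h := lintegral_image_matAct hdB ho.measurableSet
    (fun x => (k x (matAct A y) : ℝ≥0∞) ^ r * coneDelta (dualCone V) x ^ t)
  rw [show matAct (Aᵀ)⁻¹ '' dualCone V = dualCone V from hB, ofReal_abs_det_transpose_inv hd] at h
  have hΔ := coneDelta_matAct hB hdB
  rw [ofReal_abs_det_transpose_inv hd] at hΔ
  have hkA := fun x hx => hk.coe_eq hA hd (x := x) hx hy
  set a := ENNReal.ofReal |A.det|
  have hc : a ^ (β * r - t) ≠ ∞ := by simp [ENNReal.rpow_eq_top_iff, ha0, ha1]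
  rw [h, sub_eq_add_neg _ (1 : ℝ), ENNReal.rpow_add _ _ ha0 ha1, ENNReal.rpow_neg_one,
    mul_comm _ a⁻¹, mul_assoc, ← lintegral_const_mul' _ _ hc]
  congr 1
  refine setLIntegral_congr_fun ho.measurableSet fun x hx => ?_
  have hpos := (coneDelta_pos ho (fun x hx r hr => smul_mem_dualCone hx hr) hx).ne'
  rw [hkA x hx, hΔ, ENNReal.mul_rpow_of_ne_zero (ENNReal.inv_ne_zero.2 ha1) hpos,
    ENNReal.mul_rpow_of_nonneg _ _ hr, ← ENNReal.rpow_mul, ENNReal.inv_rpow,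
    ← ENNReal.rpow_neg, sub_eq_add_neg, ENNReal.rpow_add _ _ ha0 ha1]
  ring

end Homogeneous

theorem theorem3p9 {n : ℕ} (V : Set (EuclideanSpace ℝ (Fin n))) (hV : IsHomogeneousCone V)
    (p q : ℝ) (hp : 1 ≤ p) (hpq : p ≤ q) (β γ δ : ℝ)
    (k : EuclideanSpace ℝ (Fin n) → EuclideanSpace ℝ (Fin n) → ℝ≥0)
    (hkm : AEMeasurable (Function.uncurry k)
      ((volume.restrict (dualCone V)).prod (volume.restrict V)))
    (hk : IsDualHomogeneousKernel V k β)
    (h₁ : ∀ x ∈ dualCone V, ∫⁻ y in V, (k x y : ℝ≥0∞) * coneDelta V y ^ δ < ∞)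
    (h₂ : ∀ y ∈ V, ∫⁻ x in dualCone V, (k x y : ℝ≥0∞) ^ (q / p) *
      coneDelta (dualCone V) x ^ (-γ + q - 2 - (δ + β + 1) * (q * (1 - 1 / p))) < ∞) :
    ∃ c : ℝ≥0, ∀ f : EuclideanSpace ℝ (Fin n) → ℝ≥0, AEMeasurable f (volume.restrict V) →
      (∫⁻ x in dualCone V, kernelOp V k f x ^ q *
          coneDelta (dualCone V) x ^ (-γ + q - 2)) ^ (1 / q) ≤
        (c : ℝ≥0∞) * (∫⁻ y in V, (f y : ℝ≥0∞) ^ p *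
          coneDelta V y ^ (β * p + (γ + 1) * p / q - 1)) ^ (1 / p) := by
  have hp0 : 0 < p := by linarith
  have hq0 : 0 < q := by linarith
  -- A point of `V*` is needed to bound the intervals of `V`; if there is none, the left side is
  -- zero.
  rcases (dualCone V).eq_empty_or_nonempty with hemp | ⟨y₀, hy₀⟩
  · exact ⟨0, fun f _ => by simp [hemp, hq0]⟩
  have hoV := hV.isOpen
  have hoW : IsOpen (dualCone V) := isOpen_dualCone hV.smul_mem
  have hsW : ∀ x ∈ dualCone V, ∀ r : ℝ, 0 < r → r • x ∈ dualCone V :=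
    fun x hx r hr => smul_mem_dualCone hx hr
  have hΔV : ∀ y ∈ V, coneDelta V y ≠ 0 ∧ coneDelta V y ≠ ∞ := fun y hy => by
    obtain ⟨ε, hε, h⟩ := exists_pos_mul_norm_le_inner hy₀ hV.smul_mem
    exact ⟨(coneDelta_pos hoV hV.smul_mem hy).ne',
      (coneDelta_lt_top hε (fun z hz => h z (subset_closure hz)) y).ne⟩
  have hΔW : ∀ x ∈ dualCone V, coneDelta (dualCone V) x ≠ 0 ∧ coneDelta (dualCone V) x ≠ ∞ :=
    fun x hx => by
      obtain ⟨x₀, hx₀⟩ := hV.nonempty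
      obtain ⟨ε, hε, h⟩ := exists_pos_mul_norm_le_inner_dualCone hoV hx₀
      exact ⟨(coneDelta_pos hoW hsW hx).ne', (coneDelta_lt_top hε h x).ne⟩
  set t := -γ + q - 2 - (δ + β + 1) * (q * (1 - 1 / p)) with ht
  -- The sign is negative because `Δ` on `V*` scales by `|det A|⁻¹` under `(Aᵀ)⁻¹`.
  obtain ⟨C₁, hC₁⟩ := exists_eq_const_mul_rpow (e := -(δ + β + 1)) hΔW
    (fun x hx => (h₁ x hx).ne) fun x hx x' hx' => by
      obtain ⟨A, hA, rfl⟩ := hV.dualCone_transitive x hx x' hx'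
      have hd := det_ne_zero_of_mem_coneAut hV.nonempty hoV hA
      obtain ⟨ha0, ha1⟩ := ofReal_abs_det_ne hd
      refine ⟨(ENNReal.ofReal |A.det|)⁻¹, ENNReal.inv_ne_zero.2 ha1, ENNReal.inv_ne_top.2 ha0,
        ?_, ?_⟩
      · rw [coneDelta_matAct (transpose_inv_mem_coneAut_dualCone hA hd)
          (by rw [det_transpose_inv]; exact inv_ne_zero hd), ofReal_abs_det_transpose_inv hd]
      · rw [hk.lintegral_left hV.toIsOpenCone hA hx δ, ENNReal.inv_rpow, ENNReal.rpow_neg, inv_inv]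
  obtain ⟨C₂, hC₂⟩ := exists_eq_const_mul_rpow (e := β * (q / p) - t - 1) hΔV
    (fun y hy => (h₂ y hy).ne) fun y hy y' hy' => by
      obtain ⟨A, hA, rfl⟩ := hV.transitive y hy y' hy'
      have hd := det_ne_zero_of_mem_coneAut hV.nonempty hoV hA
      obtain ⟨ha0, ha1⟩ := ofReal_abs_det_ne hd
      exact ⟨ENNReal.ofReal |A.det|, ha0, ha1, coneDelta_matAct hA hd y,
        hk.lintegral_right hV.toIsOpenCone hA hy (by positivity) t⟩
  refine ⟨C₁ ^ (1 - 1 / p) * C₂ ^ (1 / q), fun f hf => ?_⟩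
  have hmem : ∀ {S : Set (EuclideanSpace ℝ (Fin n))} {P : EuclideanSpace ℝ (Fin n) → Prop},
      IsOpen S → (∀ x ∈ S, P x) → ∀ᵐ x ∂volume.restrict S, P x := fun hS hP =>
    (ae_restrict_iff' hS.measurableSet).2 (ae_of_all _ hP)
  have hmain := weighted_schur_test (k := fun x y => (k x y : ℝ≥0∞)) hkm.coe_nnreal_ennreal
    (measurable_coneDelta hoW).aemeasurable (hmem hoW hΔW)
    (measurable_coneDelta hoV).aemeasurable (hmem hoV hΔV) hp hpq
    (hmem hoW fun x hx => (hC₁ x hx).le) (hmem hoV fun y hy => (hC₂ y hy).le)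
    hf.coe_nnreal_ennreal
  -- The auxiliary `δ` drops out: `t` contributes `δ(p - 1)`, cancelling the term from Hölder.
  have hexp : -(δ * (p - 1)) + (β * (q / p) - t - 1) / (q / p) =
      β * p + (γ + 1) * p / q - 1 := by
    rw [ht]; field_simp; ring
  rw [hexp] at hmain
  exact hmain
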